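/- Let $\mathcal H$ be a real Hilbert space and let $f:\mathcal H\to\mathbb R\cup\{+\infty\}$ be a convex, lower semicontinuous and proper function with $\operatorname{argmin}_{\mathcal H} f\neq\emptyset$. Fix $\lambda>0$. For $x\in\mathcal H$ let $$f_\lambda(x)=\min_{\xi\in\mathcal H}\Big\{f(\xi)+\frac1{2\lambda}\|x-\xi\|^2\Big\}$$ be the Moreau envelope of $f$, and let $\operatorname{prox}_{\lambda f}x$ be the unique point $\xi$ at which this minimum is attained. Let $t_0>0$, $\alpha\in\mathbb R$, and let $u:[t_0,+\infty[\to\mathcal H$ be a classical (i.e. $\mathcal C^3$) solution of $$\text{(TOGES-VR)}\qquad \dddot u(t)+\frac{\alpha+7}{t}\,\ddot u(t)+\frac{5(\alpha+1)}{t^2}\,\dot u(t)+\nabla f_\lambda\Big(u(t)+\frac14t\,\dot u(t)\Big)=0,\qquad t\in[t_0,+\infty[.$$ a) Suppose that $\alpha\ge 3$. Then, as $t\to+\infty$: (i) $f_\lambda\big(u(t)+\frac14t\dot u(t)\big)-\inf_{\mathcal H}f=\mathcal O(1/t^3)$ and $f\big(\operatorname{prox}_{\lambda f}(u(t)+\frac14t\dot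 u(t))\big)-\inf_{\mathcal H}f=\mathcal O(1/t^3)$; (ii) $f_\lambda(u(t))-\inf_{\mathcal H}f=\mathcal O(1/t^3)$ and $f\big(\operatorname{prox}_{\lambda f}u(t)\big)-\inf_{\mathcal H}f=\mathcal O(1/t^3)$. b) Suppose that $\alpha>3$. Then, as $t\to+\infty$: (iii) $f_\lambda\big(u(t)+\frac14t\dot u(t)\big)-\inf_{\mathcal H}f=o(1/t^3)$ and $f\big(\operatorname{prox}_{\lambda f}(u(t)+\frac14t\dot u(t))\big)-\inf_{\mathcal H}f=o(1/t^3)$; (iv) $f_\lambda(u(t))-\inf_{\mathcal H}f=o(1/t^3)$ and $f\big(\operatorname{prox}_{\lambda f}u(t)\big)-\inf_{\mathcal H}f=o(1/t^3)$; (v) $u(t)$ converges weakly as $t\to+\infty$ to some $u_\infty\in\operatorname{argmin}_{\mathcal H}f$. -/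

import Mathlib

open Filter Topology Set Asymptotics

/-- `f : H → ℝ ∪ {+∞}` (encoded as an `EReal`-valued function that never takes the value `-∞`)
is proper: it is not identically `+∞`. -/
def IsProperFun {H : Type*} (f : H → EReal) : Prop :=
  (∀ x, f x ≠ ⊥) ∧ ∃ x, f x ≠ ⊤

/-- Convexity (Jensen's inequality) of a function with values in `ℝ ∪ {+∞}`. -/
def IsConvexFun {H : Type*} [AddCommGroup H] [Module ℝ H] (f : H → EReal) : Prop :=
  ∀ x y : H, ∀ a b : ℝ, 0 < a → 0 < b → a + b = 1 →
    f (a • x + b • y) ≤ (a : EReal) * f x + (b : EReal) * f y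

section Moreau

variable {H : Type*} [NormedAddCommGroup H]

/-- The function `ξ ↦ f ξ + (1 / (2 lam)) ‖x - ξ‖ ^ 2`. -/
noncomputable def moreauObjective (f : H → EReal) (lam : ℝ) (x ξ : H) : EReal :=
  f ξ + ((1 / (2 * lam) * ‖x - ξ‖ ^ 2 : ℝ) : EReal)

/-- The Moreau envelope `f_lam x = inf_ξ (f ξ + (1 / (2 lam)) ‖x - ξ‖ ^ 2)`, as a real-valued
function. (The infimum is a real number and it is attained: see `coe_moreauEnvelope`,
`isMinOn_prox` below.) -/
noncomputable def moreauEnvelope (f : H → EReal) (lam : ℝ) (x : H) : ℝ :=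
  (⨅ ξ, moreauObjective f lam x ξ).toReal

/-- The proximal mapping: `prox f lam x` is the minimizer of
`ξ ↦ f ξ + (1 / (2 lam)) ‖x - ξ‖ ^ 2`. (It exists and is unique: see `existsUnique_prox`.) -/
noncomputable def prox (f : H → EReal) (lam : ℝ) (x : H) : H :=
  Classical.epsilon fun p => IsMinOn (moreauObjective f lam x) univ p

end Moreau

/-- `u : [t₀, +∞[ → H` is a classical (three times continuously differentiable) solution of the
third-order evolution equation
`u''' + ((α + 7) / t) u'' + (5 (α + 1) / t ^ 2) u' + ∇ g (u + (t / 4) u') = 0` on `[t₀, +∞[`.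
Derivatives are taken within `[t₀, +∞[`, so they are one-sided at `t₀` and the values of `u`
outside `[t₀, +∞[` play no role. -/
structure IsTogesVSolution {H : Type*} [NormedAddCommGroup H] [InnerProductSpace ℝ H]
    [CompleteSpace H] (g : H → ℝ) (α t₀ : ℝ) (u : ℝ → H) : Prop where
  contDiffOn : ContDiffOn ℝ 3 u (Ici t₀)
  equation : ∀ t ∈ Ici t₀,
    iteratedDerivWithin 3 u (Ici t₀) t
      + ((α + 7) / t) • iteratedDerivWithin 2 u (Ici t₀) t
      + (5 * (α + 1) / t ^ 2) • derivWithin u (Ici t₀) t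
      + gradient g (u t + (t / 4) • derivWithin u (Ici t₀) t) = 0

/-! Well-posedness of the Moreau envelope and of the proximal mapping. -/

section WellPosed

variable {H : Type*} [NormedAddCommGroup H]

theorem le_moreauObjective {f : H → EReal} {lam : ℝ} (hlam : 0 < lam) (x ξ : H) :
    f ξ ≤ moreauObjective f lam x ξ := by
  unfold moreauObjective
  calc f ξ = f ξ + 0 := (add_zero _).symm
    _ ≤ _ := by
      gcongr
      exact_mod_cast (by positivity)

/-- The Moreau envelope is the infimum, which is a real number. -/
theorem coe_moreauEnvelope {f : H → EReal} (hf : IsProperFun f)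
    (hmin : ∃ z, IsMinOn f univ z) {lam : ℝ} (hlam : 0 < lam) (x : H) :
    ((moreauEnvelope f lam x : ℝ) : EReal) = ⨅ ξ, moreauObjective f lam x ξ := by
  obtain ⟨z, hz⟩ := hmin
  obtain ⟨y, hy⟩ := hf.2
  apply EReal.coe_toReal
  · refine ne_top_of_le_ne_top ?_ (iInf_le _ y)
    unfold moreauObjective
    exact EReal.add_ne_top hy (EReal.coe_ne_top _)
  · refine ne_bot_of_le_ne_bot (hf.1 z) (le_iInf fun ξ => ?_)
    exact (hz (mem_univ ξ)).trans (le_moreauObjective hlam x ξ)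

/-- The infimum of `f` is a real number. -/
theorem coe_toReal_iInf {X : Type*} {f : X → EReal} (hf : IsProperFun f) (hmin : ∃ z, IsMinOn f univ z) :
    (((⨅ x, f x).toReal : ℝ) : EReal) = ⨅ x, f x := by
  obtain ⟨z, hz⟩ := hmin
  obtain ⟨y, hy⟩ := hf.2
  exact EReal.coe_toReal (ne_top_of_le_ne_top hy (iInf_le _ y))
    (ne_bot_of_le_ne_bot (hf.1 z) (le_iInf fun ξ => hz (mem_univ ξ)))

theorem lowerSemicontinuous_moreauObjective {f : H → EReal} (hbot : ∀ ξ, f ξ ≠ ⊥)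
    (hf : LowerSemicontinuous f) (lam : ℝ) (x : H) :
    LowerSemicontinuous (moreauObjective f lam x) := by
  unfold moreauObjective
  refine LowerSemicontinuous.add' hf ?_ fun ξ => ?_
  · apply Continuous.lowerSemicontinuous
    exact continuous_coe_real_ereal.comp (by fun_prop)
  · exact EReal.continuousAt_add (Or.inr (EReal.coe_ne_bot _)) (Or.inl (hbot ξ))

variable [InnerProductSpace ℝ H]

theorem moreauObjective_midpoint {f : H → EReal} (hc : IsConvexFun f) {lam : ℝ} (hlam : 0 < lam)
    (x a b : H) {m r : ℝ} (hbot : ∀ ξ, f ξ ≠ ⊥)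
    (hm : ∀ ξ, (m : EReal) ≤ moreauObjective f lam x ξ)
    (ha : moreauObjective f lam x a ≤ (r : EReal)) (hb : moreauObjective f lam x b ≤ (r : EReal)) :
    ‖a - b‖ ^ 2 ≤ 8 * lam * (r - m) := by
  have htop : ∀ ξ, moreauObjective f lam x ξ ≤ (r : EReal) → f ξ ≠ ⊤ := fun ξ h h' => by
    have := (le_moreauObjective (f := f) hlam x ξ).trans h
    rw [h'] at this
    exact absurd (top_le_iff.1 this) (EReal.coe_ne_top _)
  have ea := EReal.coe_toReal (htop a ha) (hbot a)
  have eb := EReal.coe_toReal (htop b hb) (hbot b)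
  set ra := (f a).toReal
  set rb := (f b).toReal
  have hconv := hc a b (1 / 2) (1 / 2) (by norm_num) (by norm_num) (by norm_num)
  have hmid := hm ((1 / 2 : ℝ) • a + (1 / 2 : ℝ) • b)
  unfold moreauObjective at ha hb hmid
  rw [← ea] at ha
  rw [← eb] at hb
  rw [← ea, ← eb] at hconv
  have hmid2 := hmid.trans (add_le_add_left hconv _)
  norm_cast at ha hb hmid2
  have hpar := parallelogram_law_with_norm ℝ (x - a) (x - b)
  have e1 : x - ((1 / 2 : ℝ) • a + (1 / 2 : ℝ) • b) = (1 / 2 : ℝ) • ((x - a) + (x - b)) := by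
    module
  have e2 : x - a - (x - b) = b - a := by abel
  rw [e1, norm_smul] at hmid2
  rw [e2, norm_sub_rev b a] at hpar
  rw [mul_pow, Real.norm_eq_abs, abs_of_pos (by norm_num : (0 : ℝ) < 1 / 2)] at hmid2
  have hl : (1 / (2 * lam)) * lam = 1 / 2 := by field_simp
  have hS : ‖x - a + (x - b)‖ ^ 2 = 2 * ‖x - a‖ ^ 2 + 2 * ‖x - b‖ ^ 2 - ‖a - b‖ ^ 2 := by
    linarith
  rw [hS] at hmid2
  have key : (1 / (2 * lam)) * ‖a - b‖ ^ 2 ≤ 4 * (r - m) := by nlinarith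
  have := mul_le_mul_of_nonneg_left key hlam.le
  nlinarith

variable [CompleteSpace H]

/-- The proximal point exists and is unique. -/
theorem existsUnique_prox {f : H → EReal} (hf : IsProperFun f) (hc : IsConvexFun f)
    (hlsc : LowerSemicontinuous f) (hmin : ∃ z, IsMinOn f univ z) {lam : ℝ} (hlam : 0 < lam)
    (x : H) : ∃! p, IsMinOn (moreauObjective f lam x) univ p := by
  have hm := coe_moreauEnvelope hf hmin hlam x
  set m := moreauEnvelope f lam x
  have hle : ∀ ξ, (m : EReal) ≤ moreauObjective f lam x ξ := fun ξ => hm ▸ iInf_le _ ξ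
  have hex : ∀ n : ℕ, ∃ ξ, moreauObjective f lam x ξ ≤ ((m + 1 / ((n : ℝ) + 1) : ℝ) : EReal) := by
    intro n
    have : (⨅ ξ, moreauObjective f lam x ξ) < ((m + 1 / ((n : ℝ) + 1) : ℝ) : EReal) := by
      rw [← hm]
      exact_mod_cast lt_add_of_pos_right m (by positivity)
    obtain ⟨ξ, hξ⟩ := iInf_lt_iff.1 this
    exact ⟨ξ, hξ.le⟩
  choose s hs using hex
  have hlim : Tendsto (fun n : ℕ => 1 / ((n : ℝ) + 1)) atTop (𝓝 0) :=
    tendsto_one_div_add_atTop_nhds_zero_nat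
  have hmono : ∀ {k n : ℕ}, k ≤ n →
      moreauObjective f lam x (s n) ≤ ((m + 1 / ((k : ℝ) + 1) : ℝ) : EReal) := by
    intro k n hkn
    refine (hs n).trans ?_
    have := Nat.one_div_le_one_div (α := ℝ) hkn
    exact_mod_cast add_le_add_right this m
  have hcau : CauchySeq s := by
    refine cauchySeq_of_le_tendsto_0 (fun n : ℕ => √(8 * lam * (1 / ((n : ℝ) + 1)))) ?_ ?_
    · intro i j k hi hj
      rw [dist_eq_norm]
      apply Real.le_sqrt_of_sq_le
      have := moreauObjective_midpoint hc hlam x (s i) (s j) hf.1 hle (hmono hi) (hmono hj)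
      simpa using this
    · have h2 := (hlim.const_mul (8 * lam)).sqrt
      simpa using h2
  obtain ⟨p, hp⟩ := cauchySeq_tendsto_of_complete hcau
  have hpm : moreauObjective f lam x p ≤ (m : EReal) := by
    have hclosed := (lowerSemicontinuous_moreauObjective hf.1 hlsc lam x).isClosed_preimage
    have h1 : ∀ k : ℕ, moreauObjective f lam x p ≤ ((m + 1 / ((k : ℝ) + 1) : ℝ) : EReal) := by
      intro k
      refine (hclosed _).mem_of_tendsto hp ?_
      filter_upwards [eventually_ge_atTop k] with n hn using hmono hn
    have h2 : Tendsto (fun k : ℕ => ((m + 1 / ((k : ℝ) + 1) : ℝ) : EReal)) atTop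
        (𝓝 (m : EReal)) := by
      refine (continuous_coe_real_ereal.tendsto m).comp ?_
      simpa using hlim.const_add m
    exact ge_of_tendsto' h2 h1
  refine ⟨p, fun ξ _ => hpm.trans (hle ξ), fun q hq => ?_⟩
  have hqm : moreauObjective f lam x q ≤ (m : EReal) := (hq (mem_univ p)).trans hpm
  have := moreauObjective_midpoint hc hlam x q p hf.1 hle hqm hpm
  rw [sub_self, mul_zero] at this
  have h0 : ‖q - p‖ = 0 := by nlinarith [norm_nonneg (q - p)]
  exact sub_eq_zero.1 (norm_eq_zero.1 h0)

theorem isMinOn_prox {f : H → EReal} (hf : IsProperFun f) (hc : IsConvexFun f)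
    (hlsc : LowerSemicontinuous f) (hmin : ∃ z, IsMinOn f univ z) {lam : ℝ} (hlam : 0 < lam)
    (x : H) : IsMinOn (moreauObjective f lam x) univ (prox f lam x) :=
  Classical.epsilon_spec (existsUnique_prox hf hc hlsc hmin hlam x).exists

/-- The value of `f` at a proximal point is a real number. -/
theorem coe_toReal_prox {f : H → EReal} (hf : IsProperFun f) (hc : IsConvexFun f)
    (hlsc : LowerSemicontinuous f) (hmin : ∃ z, IsMinOn f univ z) {lam : ℝ} (hlam : 0 < lam)
    (x : H) : (((f (prox f lam x)).toReal : ℝ) : EReal) = f (prox f lam x) := by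
  refine EReal.coe_toReal ?_ (hf.1 _)
  obtain ⟨y, hy⟩ := hf.2
  have h := isMinOn_prox hf hc hlsc hmin hlam x (mem_univ y)
  refine ne_top_of_le_ne_top ?_ ((le_moreauObjective hlam x _).trans h)
  exact EReal.add_ne_top hy (EReal.coe_ne_top _)

end WellPosed

/-! Write `G` for the Moreau envelope: a convex differentiable function with the minimizers and
minimal value of `f`. Multiplying the third-order equation by `t / 4` turns it into the second-order
system `v'' + (a / t) v' + (t / 4) ∇G(v) = 0` for `v = u + (t / 4) u'`, with `a = α + 1`.

For a minimizer `z`, `inertialEnergy` is nonnegative and nonincreasing for every `ρ` in `[3, a -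
1]`, a nonempty range exactly when `α ≥ 3`. The choice `ρ = a - 1` bounds `t ^ 3 (G(v) - min G)`. If
`α > 3`, the energy is affine in `ρ` and converges for two values of `ρ`, so both its coefficients
converge. The constant one has limit `0` (`tendsto_energy_zero`), since otherwise the energy would
decrease like `-log t`; this gives the `o` rate and `t ‖v'‖ → 0`. The linear one then yields
convergence of `‖v - z‖`, and Opial's lemma applies.

The passage from `v` back to `u` rests on `(t ^ 4 h)' = 4 t ^ 3 (h + (t / 4) h')`, used for `h =
G(u) - min G` (with convexity) and for `h = ⟨y, u⟩`. Values of `f` at proximal points lie between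
`inf f` and `G`. -/

/-! ### Convexity and differentiability of the Moreau envelope. -/

section MoreauEnvelope

variable {H : Type*} [NormedAddCommGroup H] {f : H → EReal} {lam : ℝ}

theorem moreauEnvelope_le (hf : IsProperFun f) (hmin : ∃ z, IsMinOn f univ z) (hlam : 0 < lam)
    (x : H) {ξ : H} {r : ℝ} (hr : f ξ ≤ (r : EReal)) :
    moreauEnvelope f lam x ≤ r + 1 / (2 * lam) * ‖x - ξ‖ ^ 2 := by
  have h := coe_moreauEnvelope hf hmin hlam x
  have h1 : (⨅ ξ, moreauObjective f lam x ξ) ≤ moreauObjective f lam x ξ := iInf_le _ ξ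
  rw [← h] at h1
  have h2 := h1.trans (add_le_add_left hr _)
  exact_mod_cast h2

variable [InnerProductSpace ℝ H] [CompleteSpace H]

theorem moreauEnvelope_eq (hf : IsProperFun f) (hc : IsConvexFun f)
    (hlsc : LowerSemicontinuous f) (hmin : ∃ z, IsMinOn f univ z) (hlam : 0 < lam) (x : H) :
    moreauEnvelope f lam x =
      (f (prox f lam x)).toReal + 1 / (2 * lam) * ‖x - prox f lam x‖ ^ 2 := by
  have h := coe_moreauEnvelope hf hmin hlam x
  have hp := isMinOn_prox hf hc hlsc hmin hlam x
  have h1 : (⨅ ξ, moreauObjective f lam x ξ) = moreauObjective f lam x (prox f lam x) :=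
    le_antisymm (iInf_le _ _) (le_iInf fun ξ => hp (mem_univ ξ))
  rw [h1, moreauObjective, ← coe_toReal_prox hf hc hlsc hmin hlam x] at h
  exact_mod_cast h

theorem toReal_iInf_le_prox (hf : IsProperFun f) (hc : IsConvexFun f)
    (hlsc : LowerSemicontinuous f) (hmin : ∃ z, IsMinOn f univ z) (hlam : 0 < lam) (x : H) :
    (⨅ y, f y).toReal ≤ (f (prox f lam x)).toReal := by
  have h : (⨅ y, f y) ≤ f (prox f lam x) := iInf_le _ _
  rw [← coe_toReal_iInf hf hmin, ← coe_toReal_prox hf hc hlsc hmin hlam x] at h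
  exact_mod_cast h

theorem toReal_prox_le_moreauEnvelope (hf : IsProperFun f) (hc : IsConvexFun f)
    (hlsc : LowerSemicontinuous f) (hmin : ∃ z, IsMinOn f univ z) (hlam : 0 < lam) (x : H) :
    (f (prox f lam x)).toReal ≤ moreauEnvelope f lam x := by
  rw [moreauEnvelope_eq hf hc hlsc hmin hlam x]
  exact le_add_of_nonneg_right (by positivity)

theorem toReal_iInf_le_moreauEnvelope (hf : IsProperFun f) (hc : IsConvexFun f)
    (hlsc : LowerSemicontinuous f) (hmin : ∃ z, IsMinOn f univ z) (hlam : 0 < lam) (x : H) :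
    (⨅ y, f y).toReal ≤ moreauEnvelope f lam x :=
  (toReal_iInf_le_prox hf hc hlsc hmin hlam x).trans
    (toReal_prox_le_moreauEnvelope hf hc hlsc hmin hlam x)

/-- The Moreau envelope has the same minimizers, and the same minimal value, as the function. -/
theorem moreauEnvelope_eq_toReal_iInf_iff (hf : IsProperFun f) (hc : IsConvexFun f)
    (hlsc : LowerSemicontinuous f) (hmin : ∃ z, IsMinOn f univ z) (hlam : 0 < lam) (x : H) :
    moreauEnvelope f lam x = (⨅ y, f y).toReal ↔ IsMinOn f univ x := by
  have hinf := coe_toReal_iInf hf hmin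
  constructor
  · intro h
    have h1 := moreauEnvelope_eq hf hc hlsc hmin hlam x
    have h2 := toReal_iInf_le_prox hf hc hlsc hmin hlam x
    have hpos : 0 < 1 / (2 * lam) := by positivity
    -- As `f` at the proximal point is already at least the infimum, equality leaves no room for the
    -- quadratic term.
    have h3 : ‖x - prox f lam x‖ ^ 2 = 0 := by
      have : 0 ≤ ‖x - prox f lam x‖ ^ 2 := by positivity
      nlinarith
    have hx : prox f lam x = x := (sub_eq_zero.1 (norm_eq_zero.1 (pow_eq_zero_iff two_ne_zero |>.1 h3))).symm
    rw [h3, h, mul_zero, add_zero, hx] at h1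
    have h4 := coe_toReal_prox hf hc hlsc hmin hlam x
    rw [hx, ← h1, hinf] at h4
    intro y _
    exact h4.symm.trans_le (iInf_le _ y)
  · intro hx
    refine le_antisymm ?_ (toReal_iInf_le_moreauEnvelope hf hc hlsc hmin hlam x)
    have hle : f x ≤ (((⨅ y, f y).toReal : ℝ) : EReal) := by
      rw [hinf]
      exact le_iInf fun y => hx (mem_univ y)
    simpa using moreauEnvelope_le hf hmin hlam x hle

/-- The convex combination of the two proximal points competes in the infimum at the convex
combination of `x` and `y`. -/
theorem convexOn_moreauEnvelope (hf : IsProperFun f) (hc : IsConvexFun f)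
    (hlsc : LowerSemicontinuous f) (hmin : ∃ z, IsMinOn f univ z) (hlam : 0 < lam) :
    ConvexOn ℝ univ (moreauEnvelope f lam) := by
  refine convexOn_iff_forall_pos.2 ⟨convex_univ, fun x _ y _ a b ha hb hab => ?_⟩
  have hr : f (a • prox f lam x + b • prox f lam y) ≤
      ((a * (f (prox f lam x)).toReal + b * (f (prox f lam y)).toReal : ℝ) : EReal) := by
    have h := hc (prox f lam x) (prox f lam y) a b ha hb hab
    rw [← coe_toReal_prox hf hc hlsc hmin hlam x, ← coe_toReal_prox hf hc hlsc hmin hlam y] at h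
    exact_mod_cast h
  have h1 := moreauEnvelope_le hf hmin hlam (a • x + b • y) hr
  have e : a • x + b • y - (a • prox f lam x + b • prox f lam y) =
      a • (x - prox f lam x) + b • (y - prox f lam y) := by module
  have h2 : ‖a • (x - prox f lam x) + b • (y - prox f lam y)‖ ^ 2 ≤
      a * ‖x - prox f lam x‖ ^ 2 + b * ‖y - prox f lam y‖ ^ 2 := by
    have hcv : ConvexOn ℝ univ fun x : H => ‖x‖ ^ 2 :=
      (convexOn_norm convex_univ).pow (fun _ _ => norm_nonneg _) 2
    exact hcv.2 (mem_univ _) (mem_univ _) ha.le hb.le hab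
  rw [e] at h1
  have h3 := mul_le_mul_of_nonneg_left h2 (by positivity : 0 ≤ 1 / (2 * lam))
  rw [smul_eq_mul, smul_eq_mul, moreauEnvelope_eq hf hc hlsc hmin hlam x,
    moreauEnvelope_eq hf hc hlsc hmin hlam y]
  linarith

/-- The proximal point of `x` competes in the infimum at `x + h`; the rest is expansion of the
square. -/
theorem moreauEnvelope_le_quadratic (hf : IsProperFun f) (hc : IsConvexFun f)
    (hlsc : LowerSemicontinuous f) (hmin : ∃ z, IsMinOn f univ z) (hlam : 0 < lam) (x h : H) :
    moreauEnvelope f lam (x + h) ≤ moreauEnvelope f lam x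
      + inner ℝ ((1 / lam) • (x - prox f lam x)) h + 1 / (2 * lam) * ‖h‖ ^ 2 := by
  have h1 := moreauEnvelope_le hf hmin hlam (x + h) (coe_toReal_prox hf hc hlsc hmin hlam x).ge
  rw [moreauEnvelope_eq hf hc hlsc hmin hlam x, real_inner_smul_left]
  have e : x + h - prox f lam x = (x - prox f lam x) + h := by abel
  rw [e, norm_add_sq_real] at h1
  have e2 : 1 / lam = 1 / (2 * lam) * 2 := by field_simp
  rw [e2]
  linarith

/-- The quadratic upper bound at `h` is one half. For the lower bound, midpoint convexity gives `2
G(x) ≤ G(x + h) + G(x - h)`, and the upper bound at `-h` controls the last term. No continuity of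
`prox` is needed. -/
theorem hasGradientAt_moreauEnvelope (hf : IsProperFun f) (hc : IsConvexFun f)
    (hlsc : LowerSemicontinuous f) (hmin : ∃ z, IsMinOn f univ z) (hlam : 0 < lam) (x : H) :
    HasGradientAt (moreauEnvelope f lam) ((1 / lam) • (x - prox f lam x)) x := by
  rw [hasGradientAt_iff_isLittleO_nhds_zero]
  have hO : (fun h : H => moreauEnvelope f lam (x + h) - moreauEnvelope f lam x
      - inner ℝ ((1 / lam) • (x - prox f lam x)) h) =O[𝓝 0] fun h : H => ‖h‖ ^ 2 := by
    refine IsBigO.of_bound (1 / (2 * lam)) (Eventually.of_forall fun h => ?_)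
    rw [Real.norm_eq_abs, norm_pow, norm_norm, abs_le]
    have h1 := moreauEnvelope_le_quadratic hf hc hlsc hmin hlam x h
    have h2 := moreauEnvelope_le_quadratic hf hc hlsc hmin hlam x (-h)
    rw [inner_neg_right, norm_neg] at h2
    have h3 := (convexOn_moreauEnvelope hf hc hlsc hmin hlam).2 (mem_univ (x + h))
      (mem_univ (x + -h)) (by norm_num : (0 : ℝ) ≤ 1 / 2) (by norm_num : (0 : ℝ) ≤ 1 / 2)
      (by norm_num)
    have e : (1 / 2 : ℝ) • (x + h) + (1 / 2 : ℝ) • (x + -h) = x := by module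
    rw [e, smul_eq_mul, smul_eq_mul] at h3
    constructor <;> linarith
  refine hO.trans_isLittleO ?_
  simpa using (isLittleO_norm_pow_id (E' := H) one_lt_two)

/-- On the line through `x` and `y`, the derivative at `0` is at most the secant slope over `[0,
1]`. -/
theorem moreauEnvelope_add_inner_le (hf : IsProperFun f) (hc : IsConvexFun f)
    (hlsc : LowerSemicontinuous f) (hmin : ∃ z, IsMinOn f univ z) (hlam : 0 < lam) (x y : H) :
    moreauEnvelope f lam x + inner ℝ (gradient (moreauEnvelope f lam) x) (y - x)
      ≤ moreauEnvelope f lam y := by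
  have hg := hasGradientAt_moreauEnvelope hf hc hlsc hmin hlam x
  rw [← hg.gradient] at hg
  set D := gradient (moreauEnvelope f lam) x
  have hl : HasDerivAt (fun s : ℝ => x + s • (y - x)) (y - x) 0 := by
    simpa using ((hasDerivAt_id (0 : ℝ)).smul_const (y - x)).const_add x
  have hd : HasDerivAt (fun s : ℝ => moreauEnvelope f lam (x + s • (y - x))) (inner ℝ D (y - x)) 0 := by
    have h0 : HasFDerivAt (moreauEnvelope f lam) (InnerProductSpace.toDual ℝ H D)
        (x + (0 : ℝ) • (y - x)) := by simpa using hg.hasFDerivAt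
    have h1 := h0.comp_hasDerivAt (0 : ℝ) hl
    rwa [InnerProductSpace.toDual_apply_apply] at h1
  have hcv : ConvexOn ℝ univ (fun s : ℝ => moreauEnvelope f lam (x + s • (y - x))) := by
    have := (convexOn_moreauEnvelope hf hc hlsc hmin hlam).comp_affineMap (AffineMap.lineMap x y)
    simpa [Function.comp_def, AffineMap.lineMap_apply, add_comm] using this
  have := hcv.le_slope_of_hasDerivAt (mem_univ 0) (mem_univ 1) one_pos hd
  simp [slope_def_field] at this
  linarith

end MoreauEnvelope

/-! ### Differential inequalities on a half-line. -/

section RealAnalysis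

theorem antitoneOn_Ici_of_hasDerivAt_nonpos {e e' : ℝ → ℝ} {T : ℝ}
    (he : ∀ t, T ≤ t → HasDerivAt e (e' t) t) (hle : ∀ t, T ≤ t → e' t ≤ 0) :
    AntitoneOn e (Ici T) := by
  refine antitoneOn_of_hasDerivWithinAt_nonpos (f' := e') (convex_Ici T)
    (fun t ht => (he t ht).continuousAt.continuousWithinAt) (fun t ht => ?_) (fun t ht => ?_)
  · exact (he t (interior_subset ht)).hasDerivWithinAt
  · exact hle t (interior_subset ht)

theorem exists_tendsto_atTop_of_antitoneOn_Ici {e : ℝ → ℝ} {T c : ℝ} (he : AntitoneOn e (Ici T))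
    (hc : ∀ t, T ≤ t → c ≤ e t) : ∃ l, Tendsto e atTop (𝓝 l) := by
  have ha : Antitone fun t => e (max T t) := fun s t hst =>
    he (le_max_left T s) (le_max_left T t) (max_le_max le_rfl hst)
  have hb : BddBelow (range fun t => e (max T t)) :=
    ⟨c, by rintro _ ⟨t, rfl⟩; exact hc _ (le_max_left T t)⟩
  refine ⟨_, (tendsto_atTop_ciInf ha hb).congr' ?_⟩
  filter_upwards [eventually_ge_atTop T] with t ht
  rw [max_eq_right ht]

/-- If `h + (t / 4) h'` is eventually at most `c / t ^ k` with `k ≤ 3`, then so is `h`, up to a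
constant factor. -/
theorem eventually_le_div_pow_of_add_deriv_le {h h' : ℝ → ℝ} {c c' : ℝ} {k : ℕ} (hk : k ≤ 3)
    (hd : ∀ᶠ t in atTop, HasDerivAt h (h' t) t) (hc : 0 ≤ c)
    (hle : ∀ᶠ t in atTop, h t + t / 4 * h' t ≤ c / t ^ k) (hcc : 4 * c < c') :
    ∀ᶠ t in atTop, h t ≤ c' / t ^ k := by
  obtain ⟨i, hi⟩ := Nat.exists_eq_add_of_le hk
  obtain ⟨T, hT⟩ := eventually_atTop.1 ((hd.and hle).and (eventually_gt_atTop 0))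
  -- With `i = 3 - k`, the derivative of `t ^ 4 h` is `4 t ^ 3 (h + (t / 4) h') ≤ 4 c t ^ i`, which
  -- is at most the derivative of `4 c t ^ (i + 1)`.
  have hanti : AntitoneOn (fun t => t ^ 4 * h t - 4 * c * t ^ (i + 1)) (Ici T) := by
    refine antitoneOn_Ici_of_hasDerivAt_nonpos
      (e' := fun t => (4 * t ^ 3 * h t + t ^ 4 * h' t) - 4 * c * ((i + 1 : ℕ) * t ^ i))
      (fun t ht => ?_) (fun t ht => ?_)
    · obtain ⟨⟨h1, -⟩, -⟩ := hT t ht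
      have h2 := ((hasDerivAt_pow 4 t).fun_mul h1).fun_sub
        ((hasDerivAt_pow (i + 1) t).const_mul (4 * c))
      exact h2
    · obtain ⟨⟨-, h2⟩, h3⟩ := hT t ht
      have h4 : h t + t / 4 * h' t ≤ c * t ^ i / t ^ 3 := by
        refine h2.trans_eq ?_
        rw [hi, pow_add]
        field_simp
      rw [le_div_iff₀ (by positivity)] at h4
      have h5 : 0 ≤ c * t ^ i * i := by positivity
      push_cast
      nlinarith
  -- The strict inequality `4 c < c'` leaves room to absorb the initial value.
  have hev : ∀ᶠ t : ℝ in atTop, T ^ 4 * h T ≤ (c' - 4 * c) * t ^ (i + 1) :=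
    ((tendsto_pow_atTop (α := ℝ) i.succ_ne_zero).const_mul_atTop
      (sub_pos.2 hcc)).eventually_ge_atTop _
  have hT0 : 0 < T := (hT T le_rfl).2
  filter_upwards [hev, eventually_ge_atTop T] with t h1 ht
  have ht0 : 0 < t := hT0.trans_le ht
  have h2 := hanti self_mem_Ici ht ht
  simp only at h2
  have h3 : 0 ≤ 4 * c * T ^ (i + 1) := by positivity
  rw [le_div_iff₀ (by positivity)]
  have h4 : h t * t ^ k * t ^ (i + 1) ≤ c' * t ^ (i + 1) := by
    have : h t * t ^ k * t ^ (i + 1) = t ^ 4 * h t := by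
      rw [mul_assoc, ← pow_add, ← add_assoc, ← hi]; ring
    rw [this]; linarith
  exact le_of_mul_le_mul_right h4 (by positivity)

/-- If `h + (t / 4) h'` tends to `l` at infinity, then so does `h`. -/
theorem tendsto_of_tendsto_add_deriv {h h' : ℝ → ℝ} {l : ℝ}
    (hd : ∀ᶠ t in atTop, HasDerivAt h (h' t) t)
    (hl : Tendsto (fun t => h t + t / 4 * h' t) atTop (𝓝 l)) : Tendsto h atTop (𝓝 l) := by
  refine tendsto_order.2 ⟨fun a ha => ?_, fun b hb => ?_⟩
  -- Case `k = 0`: a gap of at most `(l - a) / 16` for the combination gives one of at most `(l - a)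
  -- / 2` for `h`, hence the strict inequality `a < h t`.
  · have h1 := eventually_le_div_pow_of_add_deriv_le (h := fun t => l - h t) (h' := fun t => - h' t)
      (c := (l - a) / 16) (c' := (l - a) / 2) (k := 0) (by norm_num)
      (hd.mono fun t ht => by simpa using ht.const_sub l) (by linarith)
      ((hl.eventually_const_le (show l - (l - a) / 16 < l by linarith)).mono fun t ht => by
        simp; linarith) (by linarith)
    filter_upwards [h1] with t ht
    simp at ht; linarith
  · have h1 := eventually_le_div_pow_of_add_deriv_le (h := fun t => h t - l) (h' := fun t => h' t)
      (c := (b - l) / 16) (c' := (b - l) / 2) (k := 0) (by norm_num)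
      (hd.mono fun t ht => by simpa using ht.sub_const l) (by linarith)
      ((hl.eventually_le_const (show l < l + (b - l) / 16 by linarith)).mono fun t ht => by
        simp; linarith) (by linarith)
    filter_upwards [h1] with t ht
    simp at ht; linarith

/-- A function bounded below on `[T, ∞)` cannot decrease at the rate `c / t` with `c > 0`. -/
theorem not_eventually_deriv_le_neg_div {e e' : ℝ → ℝ} {b c : ℝ} (hc : 0 < c)
    (hd : ∀ᶠ t in atTop, HasDerivAt e (e' t) t) (hb : ∀ᶠ t in atTop, b ≤ e t) :
    ¬ ∀ᶠ t in atTop, e' t ≤ -c / t := by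
  intro hle
  obtain ⟨T, hT⟩ := eventually_atTop.1 ((hd.and hle).and (hb.and (eventually_gt_atTop 0)))
  -- Monotonicity of this sum would force `e` to `-∞`.
  have hanti : AntitoneOn (fun t => e t + c * Real.log t) (Ici T) := by
    refine antitoneOn_Ici_of_hasDerivAt_nonpos (e' := fun t => e' t + c * t⁻¹)
      (fun t ht => ?_) (fun t ht => ?_)
    · obtain ⟨⟨h1, -⟩, -, h3⟩ := hT t ht
      exact h1.add ((Real.hasDerivAt_log h3.ne').const_mul c)
    · obtain ⟨⟨-, h2⟩, -⟩ := hT t ht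
      rw [neg_div, div_eq_mul_inv] at h2
      linarith
  have h1 := (Real.tendsto_log_atTop.const_mul_atTop hc).eventually_gt_atTop
    (e T + c * Real.log T - b)
  obtain ⟨t, h1, ht⟩ := (h1.and (eventually_ge_atTop T)).exists
  have h2 := hanti self_mem_Ici ht ht
  have h3 := (hT t ht).2.1
  simp only at h2
  linarith

end RealAnalysis

/-! ### Weak limits in Hilbert spaces. -/

section WeakConvergence

variable {H : Type*} [NormedAddCommGroup H] [InnerProductSpace ℝ H] [CompleteSpace H]

/-- By Riesz representation, the functionals defining the weak topology are the inner products. -/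
theorem tendsto_toWeakSpace_iff {ι : Type*} {l : Filter ι} {v : ι → H} {p : H} :
    Tendsto (fun t => toWeakSpace ℝ H (v t)) l (𝓝 (toWeakSpace ℝ H p)) ↔
      ∀ w : H, Tendsto (fun t => inner ℝ w (v t)) l (𝓝 (inner ℝ w p)) := by
  refine (WeakBilin.tendsto_iff_forall_eval_tendsto (topDualPairing ℝ H).flip ?_).trans ?_
  · intro x y hxy
    refine ext_inner_left ℝ fun w => ?_
    exact LinearMap.congr_fun hxy (InnerProductSpace.toDual ℝ H w)
  · constructor
    · intro h w
      exact h (InnerProductSpace.toDual ℝ H w)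
    · intro h y
      have := h ((InnerProductSpace.toDual ℝ H).symm y)
      simp only [InnerProductSpace.toDual_symm_apply] at this
      exact this

/-- Bounded families in a Hilbert space have weak limits along ultrafilters. -/
theorem exists_weak_limit_of_norm_le {ι : Type*} (U : Ultrafilter ι) {v : ι → H} {R : ℝ}
    (hv : ∀ᶠ t in U, ‖v t‖ ≤ R) :
    ∃ p : H, ∀ w : H, Tendsto (fun t => inner ℝ w (v t)) U (𝓝 (inner ℝ w p)) := by
  -- Riesz representation moves the family to the dual, where Banach–Alaoglu makes balls weak-*
  -- compact.
  let F : ι → WeakDual ℝ H := fun t => StrongDual.toWeakDual (InnerProductSpace.toDual ℝ H (v t))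
  obtain ⟨ψ, -, hψ⟩ := (WeakDual.isCompact_closedBall
    (0 : StrongDual ℝ H) R).ultrafilter_le_nhds (U.map F) (by
      rw [le_principal_iff, Ultrafilter.coe_map, mem_map]
      filter_upwards [hv] with t ht
      simpa [F] using ht)
  refine ⟨(InnerProductSpace.toDual ℝ H).symm (WeakDual.toStrongDual ψ), fun w => ?_⟩
  have h1 : Tendsto F U (𝓝 ψ) := hψ
  have h2 := ((WeakDual.eval_continuous w).tendsto ψ).comp h1
  rw [real_inner_comm, InnerProductSpace.toDual_symm_apply]
  refine h2.congr fun t => ?_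
  simp [F, real_inner_comm]

/-- **Opial's lemma**. -/
theorem exists_weak_limit_of_opial {ι : Type*} {l : Filter ι} [l.NeBot] {v : ι → H} {S : Set H}
    (hS : S.Nonempty) (hdist : ∀ z ∈ S, ∃ d, Tendsto (fun t => ‖v t - z‖) l (𝓝 d))
    (hcluster : ∀ (U : Ultrafilter ι) (p : H), (U : Filter ι) ≤ l →
      (∀ w : H, Tendsto (fun t => inner ℝ w (v t)) U (𝓝 (inner ℝ w p))) → p ∈ S) :
    ∃ p ∈ S, ∀ w : H, Tendsto (fun t => inner ℝ w (v t)) l (𝓝 (inner ℝ w p)) := by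
  obtain ⟨R, hR⟩ : ∃ R : ℝ, ∀ᶠ t in l, ‖v t‖ ≤ R := by
    obtain ⟨z, hz⟩ := hS
    obtain ⟨d, hd⟩ := hdist z hz
    refine ⟨d + 1 + ‖z‖, (hd.eventually_le_const (lt_add_one d)).mono fun t ht => ?_⟩
    have := norm_add_le (v t - z) z
    rw [sub_add_cancel] at this
    linarith
  have hex : ∀ U : Ultrafilter ι, (U : Filter ι) ≤ l → ∃ p ∈ S,
      ∀ w : H, Tendsto (fun t => inner ℝ w (v t)) U (𝓝 (inner ℝ w p)) := fun U hU => by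
    obtain ⟨p, hp⟩ := exists_weak_limit_of_norm_le U (hU hR)
    exact ⟨p, hcluster U p hU hp, hp⟩
  obtain ⟨p, hpS, hp⟩ := hex (Ultrafilter.of l) (Ultrafilter.of_le l)
  refine ⟨p, hpS, fun w => tendsto_iff_ultrafilter _ _ _ |>.2 fun U hU => ?_⟩
  obtain ⟨q, hqS, hq⟩ := hex U hU
  suffices q = p from this ▸ hq w
  obtain ⟨dp, hdp⟩ := hdist p hpS
  obtain ⟨dq, hdq⟩ := hdist q hqS
  -- In `‖v - p‖ ^ 2 - ‖v - q‖ ^ 2` the quadratic terms in `v` cancel, so the inner product with `q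
  -- - p` converges along all of `l` and takes the same value at `p` and `q`.
  have hlim : Tendsto (fun t => inner ℝ (q - p) (v t)) l
      (𝓝 ((dp ^ 2 - dq ^ 2 + ‖q‖ ^ 2 - ‖p‖ ^ 2) / 2)) := by
    refine (((((hdp.pow 2).sub (hdq.pow 2)).add_const (‖q‖ ^ 2)).sub_const
      (‖p‖ ^ 2)).div_const 2).congr fun t => ?_
    rw [norm_sub_sq_real, norm_sub_sq_real, inner_sub_left, real_inner_comm p, real_inner_comm q]
    ring
  have h1 := tendsto_nhds_unique (hp (q - p)) (hlim.mono_left (Ultrafilter.of_le l))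
  have h2 := tendsto_nhds_unique (hq (q - p)) (hlim.mono_left hU)
  have h3 : inner ℝ (q - p) (q - p) = 0 := by
    rw [inner_sub_right, h1, h2, sub_self]
  exact sub_eq_zero.1 (inner_self_eq_zero.1 h3)

end WeakConvergence

/-! ### Lyapunov analysis of the second-order inertial system. -/

section Inertial

variable {H : Type*} [NormedAddCommGroup H] [InnerProductSpace ℝ H]

/-- The Lyapunov function of the inertial system, anchored at the point `z`. -/
noncomputable def inertialEnergy (G : H → ℝ) (a : ℝ) (v w : ℝ → H) (z : H) (ρ t : ℝ) : ℝ :=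
  (t ^ 3 / 4 * (G (v t) - G z) + t ^ 2 / 2 * ‖w t‖ ^ 2)
    + ρ * (t * inner ℝ (v t - z) (w t) + (a - 1) / 2 * ‖v t - z‖ ^ 2)

variable {G : H → ℝ} {a T : ℝ} {v w : ℝ → H} {z : H}

/-- Completing the square exhibits the energy at a minimizer as nonnegative for `0 ≤ ρ ≤ a - 1` and
`t ≥ 0`; the defining form is the one affine in `ρ`. -/
theorem inertialEnergy_eq (ρ t : ℝ) :
    inertialEnergy G a v w z ρ t = t ^ 3 / 4 * (G (v t) - G z)
      + 1 / 2 * ‖ρ • (v t - z) + t • w t‖ ^ 2 + ρ * (a - 1 - ρ) / 2 * ‖v t - z‖ ^ 2 := by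
  rw [inertialEnergy, norm_add_sq_real, norm_smul, norm_smul, mul_pow, mul_pow, Real.norm_eq_abs,
    Real.norm_eq_abs, sq_abs, sq_abs, real_inner_smul_left, real_inner_smul_right]
  ring

theorem le_inertialEnergy (ρ t : ℝ) :
    t ^ 3 / 4 * (G (v t) - G z) + ρ * (a - 1 - ρ) / 2 * ‖v t - z‖ ^ 2
      ≤ inertialEnergy G a v w z ρ t := by
  rw [inertialEnergy_eq]
  have : 0 ≤ 1 / 2 * ‖ρ • (v t - z) + t • w t‖ ^ 2 := by positivity
  linarith

variable [CompleteSpace H]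

/-- `v`, with derivative `w`, solves the inertial gradient system with asymptotically vanishing
damping and linear time scaling `v'' + (a / t) v' + (t / 4) ∇ G (v) = 0` on `[T, ∞)`. -/
structure IsInertialSolution (G : H → ℝ) (a T : ℝ) (v w : ℝ → H) : Prop where
  pos : 0 < T
  hasDerivAt : ∀ t, T ≤ t → HasDerivAt v (w t) t
  hasDerivAt_velocity : ∀ t, T ≤ t →
    HasDerivAt w (-(a / t) • w t - (t / 4) • gradient G (v t)) t

namespace IsInertialSolution

/-- The weight `(a - 1) / 2` cancels the terms in `⟨v - z, w⟩`, and the scaling `t / 4` in the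
equation cancels those in `⟨∇G(v), w⟩`. -/
theorem hasDerivAt_inertialEnergy (h : IsInertialSolution G a T v w)
    (hG : ∀ x, HasGradientAt G (gradient G x) x) (z : H) (ρ : ℝ) {t : ℝ} (ht : T ≤ t) :
    HasDerivAt (inertialEnergy G a v w z ρ)
      (3 * t ^ 2 / 4 * (G (v t) - G z) - ρ * t ^ 2 / 4 * inner ℝ (gradient G (v t)) (v t - z)
        - (a - 1 - ρ) * t * ‖w t‖ ^ 2) t := by
  have ht0 : 0 < t := h.pos.trans_le ht
  have hv := h.hasDerivAt t ht
  have hw := h.hasDerivAt_velocity t ht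
  have hGv : HasDerivAt (fun s => G (v s)) (inner ℝ (gradient G (v t)) (w t)) t := by
    have := (hG (v t)).hasFDerivAt.comp_hasDerivAt t hv
    rwa [InnerProductSpace.toDual_apply_apply] at this
  have h1 := (((hasDerivAt_pow 3 t).div_const 4).fun_mul (hGv.sub_const (G z))).fun_add
    (((hasDerivAt_pow 2 t).div_const 2).fun_mul hw.norm_sq)
  have h2 := ((hasDerivAt_id' t).fun_mul ((hv.sub_const z).inner ℝ hw)).fun_add
    ((hv.sub_const z).norm_sq.const_mul ((a - 1) / 2))
  refine (h1.fun_add (h2.const_mul ρ)).congr_deriv ?_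
  simp only [inner_sub_right, real_inner_smul_right, real_inner_self_eq_norm_sq,
    real_inner_comm (w t) (gradient G (v t)), inner_sub_left,
    real_inner_comm z, real_inner_comm (v t) (gradient G (v t))]
  field_simp
  push_cast
  ring

theorem deriv_inertialEnergy_le (hconv : ∀ x y, G x + inner ℝ (gradient G x) (y - x) ≤ G y)
    (z : H) {ρ : ℝ} (hρ : 0 ≤ ρ) (t : ℝ) :
    3 * t ^ 2 / 4 * (G (v t) - G z) - ρ * t ^ 2 / 4 * inner ℝ (gradient G (v t)) (v t - z)
        - (a - 1 - ρ) * t * ‖w t‖ ^ 2 ≤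
      -((ρ - 3) * (t ^ 2 / 4 * (G (v t) - G z)) + (a - 1 - ρ) * (t * ‖w t‖ ^ 2)) := by
  have h1 := hconv (v t) z
  rw [← neg_sub, inner_neg_right] at h1
  have h2 : 0 ≤ ρ * t ^ 2 / 4 := by positivity
  nlinarith

theorem antitoneOn_inertialEnergy (h : IsInertialSolution G a T v w)
    (hG : ∀ x, HasGradientAt G (gradient G x) x)
    (hconv : ∀ x y, G x + inner ℝ (gradient G x) (y - x) ≤ G y) (hz : ∀ x, G z ≤ G x)
    {ρ : ℝ} (h3 : 3 ≤ ρ) (ha : ρ ≤ a - 1) : AntitoneOn (inertialEnergy G a v w z ρ) (Ici T) := by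
  refine antitoneOn_Ici_of_hasDerivAt_nonpos
    (fun t ht => h.hasDerivAt_inertialEnergy hG z ρ ht) fun t ht => ?_
  refine (deriv_inertialEnergy_le hconv z (by linarith) t).trans (neg_nonpos.2 ?_)
  have ht0 : 0 < t := h.pos.trans_le ht
  have h1 := sub_nonneg.2 (hz (v t))
  have h2 := sub_nonneg.2 h3
  have h4 := sub_nonneg.2 ha
  positivity

theorem inertialEnergy_nonneg (h : IsInertialSolution G a T v w) (hz : ∀ x, G z ≤ G x)
    {ρ : ℝ} (h0 : 0 ≤ ρ) (ha : ρ ≤ a - 1) {t : ℝ} (ht : T ≤ t) :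
    0 ≤ inertialEnergy G a v w z ρ t := by
  refine le_trans ?_ (le_inertialEnergy _ t)
  have ht0 : 0 < t := h.pos.trans_le ht
  have h1 := sub_nonneg.2 (hz (v t))
  have h4 := sub_nonneg.2 ha
  positivity

theorem exists_le_div_pow_three (h : IsInertialSolution G a T v w)
    (hG : ∀ x, HasGradientAt G (gradient G x) x)
    (hconv : ∀ x y, G x + inner ℝ (gradient G x) (y - x) ≤ G y) (hz : ∀ x, G z ≤ G x)
    (ha : 4 ≤ a) : ∃ C, 0 ≤ C ∧ ∀ t, T ≤ t → G (v t) - G z ≤ C / t ^ 3 := by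
  have hE := h.inertialEnergy_nonneg hz (by linarith : 0 ≤ a - 1) le_rfl le_rfl
  -- At `ρ = a - 1` the coefficient of `‖v - z‖ ^ 2` left by the square vanishes.
  refine ⟨4 * inertialEnergy G a v w z (a - 1) T, by positivity, fun t ht => ?_⟩
  have ht0 : 0 < t := h.pos.trans_le ht
  have h1 := h.antitoneOn_inertialEnergy hG hconv hz (by linarith) le_rfl self_mem_Ici ht ht
  have h2 := (le_inertialEnergy _ t).trans h1
  rw [sub_self, mul_zero, zero_div, zero_mul, add_zero] at h2
  rw [le_div_iff₀ (by positivity)]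
  linarith

theorem exists_tendsto_inertialEnergy (h : IsInertialSolution G a T v w)
    (hG : ∀ x, HasGradientAt G (gradient G x) x)
    (hconv : ∀ x y, G x + inner ℝ (gradient G x) (y - x) ≤ G y) (hz : ∀ x, G z ≤ G x)
    {ρ : ℝ} (h3 : 3 ≤ ρ) (ha : ρ ≤ a - 1) :
    ∃ l, Tendsto (inertialEnergy G a v w z ρ) atTop (𝓝 l) :=
  exists_tendsto_atTop_of_antitoneOn_Ici (h.antitoneOn_inertialEnergy hG hconv hz h3 ha)
    fun _ ht => h.inertialEnergy_nonneg hz (by linarith) ha ht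

/-- The two parts of the inertial energy, of degree `0` and `1` in the parameter `ρ`, converge. -/
theorem exists_tendsto_parts (h : IsInertialSolution G a T v w)
    (hG : ∀ x, HasGradientAt G (gradient G x) x)
    (hconv : ∀ x y, G x + inner ℝ (gradient G x) (y - x) ≤ G y) (hz : ∀ x, G z ≤ G x)
    (ha : 4 < a) :
    (∃ l, Tendsto (fun t => t ^ 3 / 4 * (G (v t) - G z) + t ^ 2 / 2 * ‖w t‖ ^ 2) atTop (𝓝 l)) ∧
      ∃ l, Tendsto (fun t => t * inner ℝ (v t - z) (w t) + (a - 1) / 2 * ‖v t - z‖ ^ 2)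
        atTop (𝓝 l) := by
  -- The endpoints `ρ = 3` and `ρ = a - 1` are distinct as `a > 4`; two values determine an affine
  -- function of `ρ`.
  obtain ⟨l₁, h₁⟩ := h.exists_tendsto_inertialEnergy hG hconv hz le_rfl (by linarith)
  obtain ⟨l₂, h₂⟩ := h.exists_tendsto_inertialEnergy hG hconv hz (by linarith) le_rfl
  have hne : a - 4 ≠ 0 := by linarith
  constructor
  · refine ⟨_, (h₁.sub (((h₂.sub h₁).div_const (a - 4)).const_mul 3)).congr fun t => ?_⟩
    simp only [inertialEnergy]
    field_simp
    ring
  · refine ⟨_, ((h₂.sub h₁).div_const (a - 4)).congr fun t => ?_⟩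
    simp only [inertialEnergy]
    field_simp
    ring

theorem tendsto_energy_zero (h : IsInertialSolution G a T v w)
    (hG : ∀ x, HasGradientAt G (gradient G x) x)
    (hconv : ∀ x y, G x + inner ℝ (gradient G x) (y - x) ≤ G y) (hz : ∀ x, G z ≤ G x)
    (ha : 4 < a) :
    Tendsto (fun t => t ^ 3 / 4 * (G (v t) - G z) + t ^ 2 / 2 * ‖w t‖ ^ 2) atTop (𝓝 0) := by
  obtain ⟨l, hl⟩ := (h.exists_tendsto_parts hG hconv hz ha).1
  have hl0 : 0 ≤ l := by
    refine ge_of_tendsto hl ?_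
    filter_upwards [eventually_ge_atTop T] with t ht
    have ht0 : 0 < t := h.pos.trans_le ht
    have h1 := sub_nonneg.2 (hz (v t))
    positivity
  rcases hl0.eq_or_lt with rfl | hpos
  · exact hl
  exfalso
  have hδ : 0 < (a - 4) / 2 := by linarith
  -- At the midpoint `ρ = (a + 2) / 2` of `[3, a - 1]` both dissipation coefficients equal `(a - 4)
  -- / 2`, so a limit `l > 0` would make the energy decrease at rate at least `(a - 4) / 2 * (l / 2)
  -- / t`.
  refine not_eventually_deriv_le_neg_div (b := 0) (c := (a - 4) / 2 * (l / 2)) (by positivity)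
    ((eventually_ge_atTop T).mono fun t ht =>
      h.hasDerivAt_inertialEnergy hG z ((a + 2) / 2) ht)
    ((eventually_ge_atTop T).mono fun t ht =>
      h.inertialEnergy_nonneg hz (by linarith) (by linarith) ht) ?_
  filter_upwards [eventually_ge_atTop T, hl.eventually_const_le (half_lt_self hpos)] with t ht hlt
  have ht0 : 0 < t := h.pos.trans_le ht
  refine (deriv_inertialEnergy_le hconv z (by linarith) t).trans ?_
  rw [neg_div, neg_le_neg_iff, div_le_iff₀ ht0]
  have e1 : (a + 2) / 2 - 3 = (a - 4) / 2 := by ring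
  have e2 : a - 1 - (a + 2) / 2 = (a - 4) / 2 := by ring
  rw [e1, e2, ← mul_add, mul_assoc]
  refine mul_le_mul_of_nonneg_left (hlt.trans ?_) hδ.le
  have : 0 ≤ t ^ 2 / 2 * ‖w t‖ ^ 2 := by positivity
  linarith

theorem eventually_le_div_pow_three (h : IsInertialSolution G a T v w)
    (hG : ∀ x, HasGradientAt G (gradient G x) x)
    (hconv : ∀ x y, G x + inner ℝ (gradient G x) (y - x) ≤ G y) (hz : ∀ x, G z ≤ G x)
    (ha : 4 < a) {ε : ℝ} (hε : 0 < ε) : ∀ᶠ t in atTop, G (v t) - G z ≤ ε / t ^ 3 := by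
  filter_upwards [eventually_gt_atTop 0, (h.tendsto_energy_zero hG hconv hz ha).eventually_le_const
    (show 0 < ε / 4 by positivity)] with t ht hle
  rw [le_div_iff₀ (by positivity)]
  have : 0 ≤ t ^ 2 / 2 * ‖w t‖ ^ 2 := by positivity
  linarith

theorem tendsto_mul_norm_velocity (h : IsInertialSolution G a T v w)
    (hG : ∀ x, HasGradientAt G (gradient G x) x)
    (hconv : ∀ x y, G x + inner ℝ (gradient G x) (y - x) ≤ G y) (hz : ∀ x, G z ≤ G x)
    (ha : 4 < a) : Tendsto (fun t => t * ‖w t‖) atTop (𝓝 0) := by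
  have h1 : Tendsto (fun t => t ^ 2 / 2 * ‖w t‖ ^ 2) atTop (𝓝 0) := by
    refine squeeze_zero' (Eventually.of_forall fun t => by positivity) ?_
      (h.tendsto_energy_zero hG hconv hz ha)
    filter_upwards [eventually_gt_atTop 0] with t ht
    have h1 := sub_nonneg.2 (hz (v t))
    have : 0 ≤ t ^ 3 / 4 * (G (v t) - G z) := by positivity
    linarith
  have h2 := (h1.const_mul 2).sqrt
  rw [mul_zero, Real.sqrt_zero] at h2
  refine h2.congr' ?_
  filter_upwards [eventually_ge_atTop 0] with t ht
  rw [show 2 * (t ^ 2 / 2 * ‖w t‖ ^ 2) = (t * ‖w t‖) ^ 2 by ring]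
  exact Real.sqrt_sq (by positivity)

theorem exists_tendsto_norm_sub (h : IsInertialSolution G a T v w)
    (hG : ∀ x, HasGradientAt G (gradient G x) x)
    (hconv : ∀ x y, G x + inner ℝ (gradient G x) (y - x) ≤ G y) (hz : ∀ x, G z ≤ G x)
    (ha : 4 < a) : ∃ d, Tendsto (fun t => ‖v t - z‖) atTop (𝓝 d) := by
  obtain ⟨l, hl⟩ := (h.exists_tendsto_parts hG hconv hz ha).2
  obtain ⟨M, hM⟩ : ∃ M, ∀ t, T ≤ t → ‖v t - z‖ ≤ M := by
    -- At `ρ = 3` the coefficient `ρ (a - 1 - ρ) / 2` is `3 (a - 4) / 2 > 0`, so the energy controls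
    -- the distance.
    refine ⟨√(inertialEnergy G a v w z 3 T / (3 * (a - 4) / 2)), fun t ht => ?_⟩
    have ht0 : 0 < t := h.pos.trans_le ht
    have h1 := (le_inertialEnergy _ t).trans
      (h.antitoneOn_inertialEnergy hG hconv hz le_rfl (by linarith) self_mem_Ici ht ht)
    have h2 := sub_nonneg.2 (hz (v t))
    have h3 : 0 ≤ t ^ 3 / 4 * (G (v t) - G z) := by positivity
    refine Real.le_sqrt_of_sq_le ?_
    rw [le_div_iff₀ (by linarith)]
    linarith
  have h0 : Tendsto (fun t => t * inner ℝ (v t - z) (w t)) atTop (𝓝 0) := by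
    have hlim := (h.tendsto_mul_norm_velocity hG hconv hz ha).const_mul M
    rw [mul_zero] at hlim
    refine squeeze_zero_norm' ?_ hlim
    filter_upwards [eventually_ge_atTop T] with t ht
    have ht0 : 0 < t := h.pos.trans_le ht
    rw [norm_mul, Real.norm_of_nonneg ht0.le]
    calc t * ‖inner ℝ (v t - z) (w t)‖ ≤ t * (‖v t - z‖ * ‖w t‖) := by
          gcongr; exact norm_inner_le_norm _ _
      _ ≤ t * (M * ‖w t‖) := by gcongr; exact hM t ht
      _ = M * (t * ‖w t‖) := by ring
  refine ⟨_, ((hl.sub h0).div_const ((a - 1) / 2)).sqrt.congr fun t => ?_⟩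
  have hne : (a - 1) / 2 ≠ 0 := by linarith
  rw [add_sub_cancel_left, mul_div_cancel_left₀ _ hne, Real.sqrt_sq (norm_nonneg _)]

/-- Weak convergence of the solutions of the inertial system to a minimizer. -/
theorem exists_weak_limit (h : IsInertialSolution G a T v w)
    (hG : ∀ x, HasGradientAt G (gradient G x) x)
    (hconv : ∀ x y, G x + inner ℝ (gradient G x) (y - x) ≤ G y) (hz : ∀ x, G z ≤ G x)
    (ha : 4 < a) : ∃ p, (∀ x, G p ≤ G x) ∧
      ∀ y : H, Tendsto (fun t => inner ℝ y (v t)) atTop (𝓝 (inner ℝ y p)) := by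
  refine exists_weak_limit_of_opial (S := {p | ∀ x, G p ≤ G x}) ⟨z, hz⟩
    (fun q hq => h.exists_tendsto_norm_sub hG hconv hq ha) fun U p hU hp x => ?_
  refine le_trans ?_ (hz x)
  -- Weak lower semicontinuity by hand: the affine minorant of `G` at `p`, evaluated at `v t`, tends
  -- to `G p`.
  have h1 : Tendsto (fun t => G p + inner ℝ (gradient G p) (v t - p)) U (𝓝 (G p)) := by
    have := ((hp (gradient G p)).sub_const (inner ℝ (gradient G p) p)).const_add (G p)
    simpa [inner_sub_right] using this
  refine le_of_forall_pos_le_add fun ε hε => ?_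
  refine le_of_tendsto h1 (hU ?_)
  filter_upwards [h.eventually_le_div_pow_three hG hconv hz ha hε, eventually_ge_atTop 1]
    with t h2 ht
  have h3 : ε / t ^ 3 ≤ ε := div_le_self hε.le (one_le_pow₀ ht)
  linarith [hconv p (v t)]

end IsInertialSolution

end Inertial

/-! ### Reduction of the third-order equation and return to `u`. -/

section Toges

variable {H : Type*} [NormedAddCommGroup H] [InnerProductSpace ℝ H] [CompleteSpace H]
  {G : H → ℝ} {α t₀ : ℝ} {u : ℝ → H}

namespace IsTogesVSolution

theorem hasDerivAt_iteratedDerivWithin (hu : IsTogesVSolution G α t₀ u) {n : ℕ} (hn : n < 3)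
    {t : ℝ} (ht : t₀ < t) :
    HasDerivAt (iteratedDerivWithin n u (Ici t₀)) (iteratedDerivWithin (n + 1) u (Ici t₀) t) t := by
  have h1 := hu.contDiffOn.differentiableOn_iteratedDerivWithin (m := n) (by exact_mod_cast hn)
    (uniqueDiffOn_Ici t₀) t ht.le
  rw [iteratedDerivWithin_succ]
  exact h1.hasDerivWithinAt.hasDerivAt (Ici_mem_nhds ht)

theorem hasDerivAt (hu : IsTogesVSolution G α t₀ u) {t : ℝ} (ht : t₀ < t) :
    HasDerivAt u (derivWithin u (Ici t₀) t) t := by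
  have := hu.hasDerivAt_iteratedDerivWithin (n := 0) (by norm_num) ht
  rwa [iteratedDerivWithin_zero, zero_add, iteratedDerivWithin_one] at this

theorem hasDerivAt_derivWithin (hu : IsTogesVSolution G α t₀ u) {t : ℝ} (ht : t₀ < t) :
    HasDerivAt (derivWithin u (Ici t₀)) (iteratedDerivWithin 2 u (Ici t₀) t) t := by
  have := hu.hasDerivAt_iteratedDerivWithin (n := 1) (by norm_num) ht
  rwa [iteratedDerivWithin_one] at this

/-- The extrapolation `u + (t / 4) u'` of a solution of the third-order equation solves an inertial
system of second order. -/
theorem isInertialSolution (hu : IsTogesVSolution G α t₀ u) (ht₀ : 0 < t₀) :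
    IsInertialSolution G (α + 1) (t₀ + 1) (fun t => u t + (t / 4) • derivWithin u (Ici t₀) t)
      (fun t => (5 / 4 : ℝ) • derivWithin u (Ici t₀) t
        + (t / 4) • iteratedDerivWithin 2 u (Ici t₀) t) where
  pos := by linarith
  hasDerivAt t ht := by
    -- Starting at `t₀ + 1` keeps `t` interior to `[t₀, ∞)`, so derivatives within that set are
    -- genuine derivatives.
    have ht' : t₀ < t := by linarith
    have h := (hu.hasDerivAt ht').fun_add
      (((hasDerivAt_id' t).div_const 4).fun_smul (hu.hasDerivAt_derivWithin ht'))
    refine h.congr_deriv ?_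
    module
  hasDerivAt_velocity t ht := by
    have ht' : t₀ < t := by linarith
    have ht0 : t ≠ 0 := by linarith
    have h := ((hu.hasDerivAt_derivWithin ht').fun_const_smul (5 / 4 : ℝ)).fun_add
      (((hasDerivAt_id' t).div_const 4).fun_smul
        (hu.hasDerivAt_iteratedDerivWithin (n := 2) (by norm_num) ht'))
    refine h.congr_deriv ?_
    have heq := hu.equation t ht'.le
    rw [eq_neg_of_add_eq_zero_right heq]
    match_scalars <;> field_simp <;> ring

theorem hasDerivAt_comp (hu : IsTogesVSolution G α t₀ u)
    (hG : ∀ x, HasGradientAt G (gradient G x) x) (c : ℝ) {t : ℝ} (ht : t₀ < t) :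
    HasDerivAt (fun s => G (u s) - c)
      (inner ℝ (gradient G (u t)) (derivWithin u (Ici t₀) t)) t := by
  have := (hG (u t)).hasFDerivAt.comp_hasDerivAt t (hu.hasDerivAt ht)
  rw [InnerProductSpace.toDual_apply_apply] at this
  exact this.sub_const c

/-- Decay along the extrapolated trajectory `u + (t / 4) u'` passes to the trajectory `u`. -/
theorem eventually_le_of_extrapolated (hu : IsTogesVSolution G α t₀ u)
    (hG : ∀ x, HasGradientAt G (gradient G x) x)
    (hconv : ∀ x y, G x + inner ℝ (gradient G x) (y - x) ≤ G y) {m c c' : ℝ} (hc : 0 ≤ c)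
    (hcc : 4 * c < c')
    (hle : ∀ᶠ t in atTop, G (u t + (t / 4) • derivWithin u (Ici t₀) t) - m ≤ c / t ^ 3) :
    ∀ᶠ t in atTop, G (u t) - m ≤ c' / t ^ 3 := by
  refine eventually_le_div_pow_of_add_deriv_le le_rfl
    ((eventually_gt_atTop t₀).mono fun t ht => hu.hasDerivAt_comp hG m ht) hc ?_ hcc
  filter_upwards [hle] with t ht
  -- The tangent inequality at `u t` reads `G(u) + (t / 4) (G(u))' ≤ G(v)`.
  have h1 := hconv (u t) (u t + (t / 4) • derivWithin u (Ici t₀) t)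
  rw [add_sub_cancel_left, real_inner_smul_right] at h1
  linarith

end IsTogesVSolution

theorem isBigO_one_div_pow_of_eventually_le {φ : ℝ → ℝ} {c : ℝ} {k : ℕ} (h0 : ∀ t, 0 ≤ φ t)
    (hle : ∀ᶠ t in atTop, φ t ≤ c / t ^ k) : φ =O[atTop] fun t => 1 / t ^ k := by
  refine IsBigO.of_bound c ?_
  filter_upwards [hle, eventually_gt_atTop 0] with t ht hpos
  rwa [Real.norm_of_nonneg (h0 t), Real.norm_of_nonneg (by positivity), mul_one_div]

theorem isLittleO_one_div_pow_of_eventually_le {φ : ℝ → ℝ} {k : ℕ} (h0 : ∀ t, 0 ≤ φ t)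
    (hle : ∀ ε > 0, ∀ᶠ t in atTop, φ t ≤ ε / t ^ k) : φ =o[atTop] fun t => 1 / t ^ k := by
  refine isLittleO_iff.2 fun ε hε => ?_
  filter_upwards [hle ε hε, eventually_gt_atTop 0] with t ht hpos
  rwa [Real.norm_of_nonneg (h0 t), Real.norm_of_nonneg (by positivity), mul_one_div]

end Toges

theorem theorem6p1 {H : Type*} [NormedAddCommGroup H] [InnerProductSpace ℝ H] [CompleteSpace H]
    (f : H → EReal) (hproper : IsProperFun f) (hconvex : IsConvexFun f)
    (hlsc : LowerSemicontinuous f) (hmin : ∃ z, IsMinOn f univ z)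
    (lam : ℝ) (hlam : 0 < lam) (α t₀ : ℝ) (ht₀ : 0 < t₀)
    (u : ℝ → H) (hu : IsTogesVSolution (moreauEnvelope f lam) α t₀ u) :
    (3 ≤ α →
      ((fun t : ℝ => moreauEnvelope f lam (u t + (t / 4) • derivWithin u (Ici t₀) t)
          - (⨅ x, f x).toReal) =O[atTop] fun t : ℝ => 1 / t ^ 3) ∧
      ((fun t : ℝ => (f (prox f lam (u t + (t / 4) • derivWithin u (Ici t₀) t))).toReal
          - (⨅ x, f x).toReal) =O[atTop] fun t : ℝ => 1 / t ^ 3) ∧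
      ((fun t : ℝ => moreauEnvelope f lam (u t) - (⨅ x, f x).toReal)
          =O[atTop] fun t : ℝ => 1 / t ^ 3) ∧
      ((fun t : ℝ => (f (prox f lam (u t))).toReal - (⨅ x, f x).toReal)
          =O[atTop] fun t : ℝ => 1 / t ^ 3)) ∧
    (3 < α →
      ((fun t : ℝ => moreauEnvelope f lam (u t + (t / 4) • derivWithin u (Ici t₀) t)
          - (⨅ x, f x).toReal) =o[atTop] fun t : ℝ => 1 / t ^ 3) ∧
      ((fun t : ℝ => (f (prox f lam (u t + (t / 4) • derivWithin u (Ici t₀) t))).toReal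
          - (⨅ x, f x).toReal) =o[atTop] fun t : ℝ => 1 / t ^ 3) ∧
      ((fun t : ℝ => moreauEnvelope f lam (u t) - (⨅ x, f x).toReal)
          =o[atTop] fun t : ℝ => 1 / t ^ 3) ∧
      ((fun t : ℝ => (f (prox f lam (u t))).toReal - (⨅ x, f x).toReal)
          =o[atTop] fun t : ℝ => 1 / t ^ 3) ∧
      ∃ uInf : H, Tendsto (fun t : ℝ => toWeakSpace ℝ H (u t)) atTop (𝓝 (toWeakSpace ℝ H uInf)) ∧
        IsMinOn f univ uInf) := by
  have hG : ∀ x, HasGradientAt (moreauEnvelope f lam) (gradient (moreauEnvelope f lam) x) x :=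
    fun x => by
      have h := hasGradientAt_moreauEnvelope hproper hconvex hlsc hmin hlam x
      rwa [h.gradient]
  have hconv := moreauEnvelope_add_inner_le hproper hconvex hlsc hmin hlam
  have hinf := toReal_iInf_le_moreauEnvelope hproper hconvex hlsc hmin hlam
  have hprox : ∀ x, 0 ≤ (f (prox f lam x)).toReal - (⨅ y, f y).toReal := fun x =>
    sub_nonneg.2 (toReal_iInf_le_prox hproper hconvex hlsc hmin hlam x)
  have hproxle : ∀ x, (f (prox f lam x)).toReal - (⨅ y, f y).toReal ≤
      moreauEnvelope f lam x - (⨅ y, f y).toReal := fun x =>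
    sub_le_sub_right (toReal_prox_le_moreauEnvelope hproper hconvex hlsc hmin hlam x) _
  have hiff := moreauEnvelope_eq_toReal_iInf_iff hproper hconvex hlsc hmin hlam
  obtain ⟨z, hzf⟩ := hmin
  have hzeq := (hiff z).2 hzf
  have hz : ∀ x, moreauEnvelope f lam z ≤ moreauEnvelope f lam x := fun x => hzeq ▸ hinf x
  have hin := hu.isInertialSolution ht₀
  have hdom : ∀ x : ℝ → H, (fun t => (f (prox f lam (x t))).toReal - (⨅ y, f y).toReal) =O[atTop]
      fun t => moreauEnvelope f lam (x t) - (⨅ y, f y).toReal := fun x =>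
    IsBigO.of_bound 1 (Eventually.of_forall fun t => by
      rw [Real.norm_of_nonneg (hprox _), Real.norm_of_nonneg (sub_nonneg.2 (hinf _)), one_mul]
      exact hproxle _)
  refine ⟨fun hα => ?_, fun hα => ?_⟩
  · obtain ⟨C, hC, hle⟩ := hin.exists_le_div_pow_three hG hconv hz (by linarith)
    rw [hzeq] at hle
    have hle' := (eventually_ge_atTop (t₀ + 1)).mono hle
    have h1 := isBigO_one_div_pow_of_eventually_le (fun t => sub_nonneg.2 (hinf _)) hle'
    have h2 := isBigO_one_div_pow_of_eventually_le (fun t => sub_nonneg.2 (hinf _))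
      (hu.eventually_le_of_extrapolated hG hconv hC (lt_add_one _) hle')
    exact ⟨h1, (hdom _).trans h1, h2, (hdom _).trans h2⟩
  · have hle := fun ε (hε : 0 < ε) =>
      hin.eventually_le_div_pow_three hG hconv hz (by linarith) hε
    rw [hzeq] at hle
    have h1 := isLittleO_one_div_pow_of_eventually_le (fun t => sub_nonneg.2 (hinf _)) hle
    have h2 := isLittleO_one_div_pow_of_eventually_le (fun t => sub_nonneg.2 (hinf _))
      fun ε hε => hu.eventually_le_of_extrapolated hG hconv (by positivity)
        (by linarith : 4 * (ε / 8) < ε) (hle (ε / 8) (by positivity))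
    refine ⟨h1, (hdom _).trans_isLittleO h1, h2, (hdom _).trans_isLittleO h2, ?_⟩
    obtain ⟨p, hp, hlim⟩ := hin.exists_weak_limit hG hconv hz (by linarith)
    refine ⟨p, tendsto_toWeakSpace_iff.2 fun y => ?_, (hiff p).1 ?_⟩
    -- For `h = ⟨y, u⟩`, the combination `h + (t / 4) h'` is `⟨y, v⟩`, so weak convergence of `v`
    -- passes to `u` with the same limit.
    · refine tendsto_of_tendsto_add_deriv
        (h' := fun t => inner ℝ y (derivWithin u (Ici t₀) t)) ?_ ?_
      · filter_upwards [eventually_gt_atTop t₀] with t ht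
        simpa using (hasDerivAt_const t y).inner ℝ (hu.hasDerivAt ht)
      · refine (hlim y).congr fun t => ?_
        rw [inner_add_right, real_inner_smul_right]
    · exact le_antisymm ((hp z).trans_eq hzeq) (hinf p)
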